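/- Let $N,d\in\mathbb N$, let $\mu$ be the uniform probability measure on $[0,1]^d$, and let $\nu$ be a Borel probability measure on $\mathbb R^N\times\mathbb R^d$ (the law of a random vector $(X,Y)$) whose first marginal is centered, $\int x\,\nu(dx,dy)=0$. Assume that - $\operatorname{spt}(\nu)=\overline\Omega$, where $\Omega\subset\mathbb R^N\times\mathbb R^d$ is open, bounded and convex; - $\nu$ has a density with respect to Lebesgue measure on $\Omega$, still denoted $\nu$, with $\nu\in L^\infty(\Omega)$; - for every compact $K\subset\Omega$ there is $\alpha_K>0$ such that $\nu\ge\alpha_K$ a.e. on $K$. Consider the dual problem $$\inf_{(\psi,\varphi,b)}\ \int\psi\,d\nu+\int_{[0,1]^d}\varphi\,d\mu\quad\text{subject to}\quad \psi(x,y)+\varphi(t)+b(t)\cdot x\ \ge\ t\cdot y\quad\text{for all }(x,y)\in\operatorname{spt}(\nu),\ t\in[0,1]^d, \qquad (D)$$ the infimum being taken over $\psi\in C(\operatorname{spt}(\nu),\mathbb R)$, $\varphi\in C([0,1]^d,\mathbb R)$, $b\in C([0,1]^d,\mathbb R^N)$. Then $(D)$ has at least one $L^1$ solution: there exist $\psi:\overline\Omega\to(-\infty,+\infty]$,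 finite on $\Omega$, and $\varphi:[0,1]^d\to\mathbb R$, $b:[0,1]^d\to\mathbb R^N$, with $\psi\in L^1(\nu)$, $\varphi\in L^1([0,1]^d)$, $b\in L^1([0,1]^d)^N$, which satisfy the constraint in $(D)$ for all $(x,y)\in\operatorname{spt}(\nu)$ and all $t\in[0,1]^d$, and such that $\int\psi\,d\nu+\int\varphi\,d\mu$ is finite, equals the infimum in $(D)$, and is minimal among all triples $(\psi',\varphi',b')$ of this $L^1$ class (that is, $\psi':\overline\Omega\to(-\infty,+\infty]$ in $L^1(\nu)$ and real-, respectively $\mathbb R^N$-valued $\varphi',b'$ in $L^1$) that satisfy the constraint in $(D)$. -/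

import Mathlib

open MeasureTheory
open scoped ENNReal

/-- The unit cube `[0,1]^d` in Euclidean space. -/
def unitCube (d : ℕ) : Set (EuclideanSpace ℝ (Fin d)) :=
  {t | ∀ i, 0 ≤ t i ∧ t i ≤ 1}

/-- The uniform probability measure on `[0,1]^d`. -/
noncomputable def uniformCube (d : ℕ) : Measure (EuclideanSpace ℝ (Fin d)) :=
  volume.restrict (unitCube d)

/-- The pointwise constraint `ψ(x,y) + φ(t) + b(t)·x ≥ t·y` for **all**
`(x,y) ∈ spt ν` and **all** `t ∈ [0,1]^d`.  The potential `ψ` may take the value `+∞`;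
the constraint forces `ψ ≠ -∞` on `spt ν`. -/
def DualConstraint {N d : ℕ}
    (ν : Measure (EuclideanSpace ℝ (Fin N) × EuclideanSpace ℝ (Fin d)))
    (ψ : EuclideanSpace ℝ (Fin N) × EuclideanSpace ℝ (Fin d) → EReal)
    (φ : EuclideanSpace ℝ (Fin d) → ℝ)
    (b : EuclideanSpace ℝ (Fin d) → EuclideanSpace ℝ (Fin N)) : Prop :=
  ∀ z ∈ ν.support, ∀ t ∈ unitCube d,
    ((inner ℝ t z.2 : ℝ) : EReal) ≤ ψ z + ((φ t + inner ℝ (b t) z.1 : ℝ) : EReal)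

/-- The objective `E(ψ(X,Y) + φ(U)) = ∫ ψ dν + ∫ φ dμ`, with `μ` uniform on `[0,1]^d`
(used only for `ψ` that is `ν`-a.e. finite and integrable). -/
noncomputable def dualCost {N d : ℕ}
    (ν : Measure (EuclideanSpace ℝ (Fin N) × EuclideanSpace ℝ (Fin d)))
    (ψ : EuclideanSpace ℝ (Fin N) × EuclideanSpace ℝ (Fin d) → EReal)
    (φ : EuclideanSpace ℝ (Fin d) → ℝ) : ℝ :=
  (∫ z, (ψ z).toReal ∂ν) + ∫ t, φ t ∂(uniformCube d)

/-- The set of values of the objective over the continuous admissible triples: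
`ψ ∈ C(spt ν, ℝ)`, `φ ∈ C([0,1]^d, ℝ)`, `b ∈ C([0,1]^d, ℝ^N)` with the pointwise constraint.
The infimum of the dual problem is the infimum of this set. -/
def continuousDualValues {N d : ℕ}
    (ν : Measure (EuclideanSpace ℝ (Fin N) × EuclideanSpace ℝ (Fin d))) : Set ℝ :=
  {c | ∃ (ψ : EuclideanSpace ℝ (Fin N) × EuclideanSpace ℝ (Fin d) → ℝ)
      (φ : EuclideanSpace ℝ (Fin d) → ℝ)
      (b : EuclideanSpace ℝ (Fin d) → EuclideanSpace ℝ (Fin N)),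
      ContinuousOn ψ ν.support ∧ ContinuousOn φ (unitCube d) ∧ ContinuousOn b (unitCube d) ∧
      DualConstraint ν (fun z => (ψ z : EReal)) φ b ∧
      c = dualCost ν (fun z => (ψ z : EReal)) φ}

/-- Admissible triples of the dual problem in the `L¹` class: `ψ ∈ L¹(ν)` (in particular finite
`ν`-a.e.), `φ ∈ L¹([0,1]^d)`, `b ∈ L¹([0,1]^d)^N`, with the pointwise constraint. -/
structure IsL1Admissible {N d : ℕ}
    (ν : Measure (EuclideanSpace ℝ (Fin N) × EuclideanSpace ℝ (Fin d)))
    (ψ : EuclideanSpace ℝ (Fin N) × EuclideanSpace ℝ (Fin d) → EReal)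
    (φ : EuclideanSpace ℝ (Fin d) → ℝ)
    (b : EuclideanSpace ℝ (Fin d) → EuclideanSpace ℝ (Fin N)) : Prop where
  ae_finite : ∀ᵐ z ∂ν, ψ z ≠ ⊤ ∧ ψ z ≠ ⊥
  integrable_psi : Integrable (fun z => (ψ z).toReal) ν
  integrable_phi : Integrable φ (uniformCube d)
  integrable_b : Integrable b (uniformCube d)
  constraint : DualConstraint ν ψ φ b

/-- An `L¹` solution of the dual problem: an admissible `L¹` triple which attains the infimum of
the dual problem over continuous triples, and is also minimal among all admissible `L¹` triples. -/
structure IsL1DualSolution {N d : ℕ}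
    (ν : Measure (EuclideanSpace ℝ (Fin N) × EuclideanSpace ℝ (Fin d)))
    (ψ : EuclideanSpace ℝ (Fin N) × EuclideanSpace ℝ (Fin d) → EReal)
    (φ : EuclideanSpace ℝ (Fin d) → ℝ)
    (b : EuclideanSpace ℝ (Fin d) → EuclideanSpace ℝ (Fin N)) : Prop where
  admissible : IsL1Admissible ν ψ φ b
  attains_inf : IsGLB (continuousDualValues ν) (dualCost ν ψ φ)
  minimal : ∀ (ψ' : EuclideanSpace ℝ (Fin N) × EuclideanSpace ℝ (Fin d) → EReal)
    (φ' : EuclideanSpace ℝ (Fin d) → ℝ)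
    (b' : EuclideanSpace ℝ (Fin d) → EuclideanSpace ℝ (Fin N)),
    IsL1Admissible ν ψ' φ' b' → dualCost ν ψ φ ≤ dualCost ν ψ' φ'

open Filter Topology Metric

/-- A one-sided Fatou lemma for real functions which are uniformly bounded below. -/
theorem integrable_and_integral_le_of_eventually_le {α : Type*} [MeasurableSpace α]
    {μ : Measure α} [IsFiniteMeasure μ] {f : ℕ → α → ℝ} {g : α → ℝ} {C A : ℝ}
    (hf : ∀ n, Integrable (f n) μ) (hfC : ∀ n, ∀ᵐ x ∂μ, -C ≤ f n x)
    (hg : AEStronglyMeasurable g μ) (hgC : ∀ᵐ x ∂μ, -C ≤ g x)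
    (hlim : ∀ᵐ x ∂μ, ∀ ε > 0, ∀ᶠ n in atTop, g x ≤ f n x + ε)
    (hA : Tendsto (fun n => ∫ x, f n x ∂μ) atTop (𝓝 A)) :
    Integrable g μ ∧ ∫ x, g x ∂μ ≤ A := by
  have hfi : ∀ n, Integrable (fun x => f n x + C) μ := fun n => (hf n).add (integrable_const C)
  have h0 : ∀ n, 0 ≤ᵐ[μ] fun x => f n x + C := fun n => by
    filter_upwards [hfC n] with x hx
    simp only [Pi.zero_apply]; linarith
  have hg0 : 0 ≤ᵐ[μ] fun x => g x + C := by
    filter_upwards [hgC] with x hx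
    simp only [Pi.zero_apply]; linarith
  have hint : ∀ n, ∫⁻ x, ENNReal.ofReal (f n x + C) ∂μ
      = ENNReal.ofReal ((∫ x, f n x ∂μ) + C * μ.real Set.univ) := fun n => by
    rw [← ofReal_integral_eq_lintegral_ofReal (hfi n) (h0 n),
      integral_add (hf n) (integrable_const C)]
    simp [mul_comm]
  have key : ∫⁻ x, ENNReal.ofReal (g x + C) ∂μ ≤ ENNReal.ofReal (A + C * μ.real Set.univ) := by
    calc ∫⁻ x, ENNReal.ofReal (g x + C) ∂μ
        ≤ ∫⁻ x, liminf (fun n => ENNReal.ofReal (f n x + C)) atTop ∂μ := by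
          refine lintegral_mono_ae ?_
          filter_upwards [hlim] with x hx
          refine le_of_forall_lt fun a ha => ?_
          obtain ⟨a', ha1, ha2⟩ := exists_between ha
          refine ha1.trans_le (le_liminf_of_le (by isBoundedDefault) ?_)
          have hne : a' ≠ ⊤ := ne_top_of_lt ha2
          have hlt : a'.toReal < g x + C := (ENNReal.lt_ofReal_iff_toReal_lt hne).1 ha2
          filter_upwards [hx (g x + C - a'.toReal) (by linarith)] with n hn
          rw [← ENNReal.ofReal_toReal hne]
          exact ENNReal.ofReal_le_ofReal (by linarith)
      _ ≤ liminf (fun n => ∫⁻ x, ENNReal.ofReal (f n x + C) ∂μ) atTop :=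
          lintegral_liminf_le' fun n => (hfi n).aestronglyMeasurable.aemeasurable.ennreal_ofReal
      _ = ENNReal.ofReal (A + C * μ.real Set.univ) := by
          simp_rw [hint]
          exact ((ENNReal.continuous_ofReal.tendsto _).comp (hA.add_const _)).liminf_eq
  have hgi : Integrable (fun x => g x + C) μ :=
    ⟨hg.add aestronglyMeasurable_const,
      (hasFiniteIntegral_iff_ofReal hg0).2 (key.trans_lt ENNReal.ofReal_lt_top)⟩
  have hgi' : Integrable g μ := by
    convert! hgi.sub (integrable_const C) using 1
    ext; simp
  refine ⟨hgi', ?_⟩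
  rw [← ofReal_integral_eq_lintegral_ofReal hgi hg0] at key
  have h1 : 0 ≤ A + C * μ.real Set.univ :=
    ge_of_tendsto' (hA.add_const _) fun n => by
      have := integral_nonneg_of_ae (h0 n)
      rw [integral_add (hf n) (integrable_const C)] at this
      simpa [mul_comm] using this
  have h2 := (ENNReal.ofReal_le_ofReal_iff h1).1 key
  rw [integral_add hgi' (integrable_const C)] at h2
  simp only [integral_const, smul_eq_mul] at h2
  linarith

theorem measurableSet_exists_mem_le_zero {T X : Type*} [MeasurableSpace T] [PseudoMetricSpace X]
    {K : Set X} (hK : IsCompact K) {H : T → X → ℝ} (hm : ∀ x, Measurable fun t => H t x)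
    (hc : ∀ t, Continuous (H t)) : MeasurableSet {t | ∃ x ∈ K, H t x ≤ 0} := by
  obtain ⟨D, hDK, hDc, hD⟩ := hK.isSeparable.exists_countable_dense_subset
  have : {t | ∃ x ∈ K, H t x ≤ 0} = ⋂ n : ℕ, ⋃ x ∈ D, {t | H t x < 1 / ((n : ℝ) + 1)} := by
    ext t
    simp only [Set.mem_ofPred_eq, Set.mem_iInter, Set.mem_iUnion, exists_prop]
    constructor
    · rintro ⟨x, hx, hx0⟩ n
      have hopen : IsOpen {y | H t y < 1 / ((n : ℝ) + 1)} := isOpen_lt (hc t) continuous_const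
      obtain ⟨y, hy1, hy2⟩ := mem_closure_iff.1 (hD hx) _ hopen
        (hx0.trans_lt Nat.one_div_pos_of_nat)
      exact ⟨y, hy2, hy1⟩
    · intro h
      obtain ⟨x1, hx1, -⟩ := h 0
      obtain ⟨x, hx, hmin⟩ := hK.exists_isMinOn ⟨x1, hDK hx1⟩ (hc t).continuousOn
      refine ⟨x, hx, ge_of_tendsto' tendsto_one_div_add_atTop_nhds_zero_nat fun n => ?_⟩
      obtain ⟨y, hy, hyn⟩ := h n
      exact (hmin (hDK hy)).trans hyn.le
  rw [this]
  exact MeasurableSet.iInter fun n => MeasurableSet.biUnion hDc fun x _ =>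
    measurableSet_lt (hm x) measurable_const

theorem measurable_of_le_zero_iff_eq {T X : Type*} [MeasurableSpace T] [PseudoMetricSpace X]
    [SigmaCompactSpace X] [MeasurableSpace X] [BorelSpace X] {H : T → X → ℝ} {b : T → X}
    (hm : ∀ x, Measurable fun t => H t x) (hc : ∀ t, Continuous (H t))
    (hb : ∀ t x, H t x ≤ 0 ↔ x = b t) : Measurable b := by
  refine measurable_of_isClosed fun F hF => ?_
  have : b ⁻¹' F = ⋃ n, {t | ∃ x ∈ compactCovering X n ∩ F, H t x ≤ 0} := by
    ext t
    simp only [hb, Set.mem_preimage, Set.mem_iUnion, Set.mem_ofPred_eq, exists_eq_right,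
      Set.mem_inter_iff, exists_and_right, exists_mem_compactCovering, true_and]
  rw [this]
  exact MeasurableSet.iUnion fun n =>
    measurableSet_exists_mem_le_zero ((isCompact_compactCovering X n).inter_right hF) hm hc

/-- Measurable selection from nonempty convex sublevel sets of a Carathéodory function. -/
theorem exists_measurable_le_of_convexOn {T X : Type*} [MeasurableSpace T] [NormedAddCommGroup X]
    [InnerProductSpace ℝ X] [FiniteDimensional ℝ X] [MeasurableSpace X] [BorelSpace X]
    {G : T → X → ℝ} {φ : T → ℝ} (hφ : Measurable φ) (hm : ∀ x, Measurable fun t => G t x)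
    (hc : ∀ t, Continuous (G t)) (hconv : ∀ t, ConvexOn ℝ Set.univ (G t))
    (hne : ∀ t, ∃ x, G t x ≤ φ t) : ∃ b : T → X, Measurable b ∧ ∀ t, G t (b t) ≤ φ t := by
  have hmin : ∀ t, ∃ v, G t v ≤ φ t ∧ ∀ w, G t w ≤ φ t → ‖w - v‖ ^ 2 ≤ ‖w‖ ^ 2 - ‖v‖ ^ 2 := by
    intro t
    have hcv : Convex ℝ {x | G t x ≤ φ t} := by simpa using (hconv t).convex_le (φ t)
    obtain ⟨v, hv, hveq⟩ := exists_norm_eq_iInf_of_complete_convex (K := {x | G t x ≤ φ t})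
      (hne t) (isClosed_le (hc t) continuous_const).isComplete hcv 0
    refine ⟨v, hv, fun w hw => ?_⟩
    have h1 := (norm_eq_iInf_iff_real_inner_le_zero hcv hv).1 hveq w hw
    have h2 := norm_sub_sq_real w v
    rw [zero_sub, inner_neg_left, inner_sub_right, real_inner_self_eq_norm_sq] at h1
    rw [real_inner_comm] at h2
    linarith
  choose b hb hb' using hmin
  refine ⟨b, ?_, hb⟩
  have : ProperSpace X := FiniteDimensional.proper ℝ X
  have hbn : Measurable fun t => ‖b t‖ := by
    refine measurable_of_Iic fun r => ?_
    have : (fun t => ‖b t‖) ⁻¹' Set.Iic r = {t | ∃ x ∈ closedBall (0 : X) r, G t x - φ t ≤ 0} := by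
      ext t
      simp only [Set.mem_preimage, Set.mem_Iic, Set.mem_ofPred_eq, mem_closedBall, dist_zero_right,
        sub_nonpos]
      refine ⟨fun h => ⟨b t, h, hb t⟩, ?_⟩
      rintro ⟨x, hx, hxt⟩
      have := hb' t x hxt
      refine le_trans (le_of_sq_le_sq ?_ (norm_nonneg _)) hx
      nlinarith [sq_nonneg ‖x - b t‖]
    rw [this]
    exact measurableSet_exists_mem_le_zero (isCompact_closedBall _ _) (fun x => (hm x).sub hφ)
      fun t => (hc t).sub continuous_const
  refine measurable_of_le_zero_iff_eq (H := fun t x => max (G t x - φ t) (‖x‖ - ‖b t‖))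
    (fun x => ((hm x).sub hφ).max (measurable_const.sub hbn))
    (fun t => ((hc t).sub continuous_const).max (continuous_norm.sub continuous_const)) ?_
  intro t x
  rw [max_le_iff, sub_nonpos, sub_nonpos]
  refine ⟨fun h => ?_, fun h => by rw [h]; exact ⟨hb t, le_rfl⟩⟩
  have h1 := hb' t x h.1
  have h2 : ‖x‖ ^ 2 ≤ ‖b t‖ ^ 2 := by gcongr; exact h.2
  have h3 : ‖x - b t‖ ^ 2 = 0 := le_antisymm (by linarith) (sq_nonneg _)
  exact sub_eq_zero.1 (norm_eq_zero.1 (pow_eq_zero_iff two_ne_zero |>.1 h3))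

theorem integral_id_mem_of_convex_isOpen {E : Type*} [NormedAddCommGroup E] [NormedSpace ℝ E]
    [CompleteSpace E] [MeasurableSpace E] {ν : Measure E} [IsProbabilityMeasure ν] {Ω : Set E}
    (hopen : IsOpen Ω) (hconv : Convex ℝ Ω) (hmem : ∀ᵐ z ∂ν, z ∈ Ω)
    (hint : Integrable (fun z : E => z) ν) : ∫ z, z ∂ν ∈ Ω := by
  by_contra hm
  obtain ⟨L, hL⟩ := geometric_hahn_banach_open_point hconv hopen hm
  rw [← L.integral_comp_comm hint] at hL
  have hLi : Integrable (fun z => L z) ν := L.integrable_comp hint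
  have h0 : 0 ≤ᵐ[ν] fun z => (∫ w, L w ∂ν) - L z := by
    filter_upwards [hmem] with z hz
    exact sub_nonneg.2 (hL z hz).le
  have h1 : ∫ z, ((∫ w, L w ∂ν) - L z) ∂ν = 0 := by
    rw [integral_sub (integrable_const _) hLi]; simp
  have h2 := (integral_eq_zero_iff_of_nonneg_ae h0 ((integrable_const _).sub hLi)).1 h1
  obtain ⟨z, hz1, hz2⟩ := (hmem.and h2).exists
  have := hL z hz1
  simp only [Pi.zero_apply] at hz2
  linarith

/-- A convex function is at most its mean over any ball around the point. -/
theorem ConvexOn.mul_measure_closedBall_le {E : Type*} [NormedAddCommGroup E] [NormedSpace ℝ E]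
    [FiniteDimensional ℝ E] [MeasurableSpace E] [BorelSpace E] (μ : Measure E) [μ.IsAddHaarMeasure]
    {g : E → ℝ} (hg : ConvexOn ℝ Set.univ g) (w : E) (r : ℝ) :
    g w * μ.real (closedBall w r) ≤ ∫ v in closedBall w r, g v ∂μ := by
  have : ProperSpace E := FiniteDimensional.proper ℝ E
  have hgc : Continuous g := hg.locallyLipschitz.continuous
  have hK := isCompact_closedBall w r
  have hmp : MeasurePreserving (fun v => w + w - v) (μ.restrict (closedBall w r))
      (μ.restrict (closedBall w r)) := by
    have h := (Measure.measurePreserving_sub_left μ (w + w)).restrict_preimage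
      (measurableSet_closedBall (x := w) (ε := r))
    convert! h using 2
    ext v
    simp only [mem_closedBall, Set.mem_preimage, dist_eq_norm]
    rw [← norm_neg]
    congr! 2
    abel
  have hrefl : ∫ v in closedBall w r, g (w + w - v) ∂μ = ∫ v in closedBall w r, g v ∂μ :=
    hmp.integral_comp (Homeomorph.subLeft (w + w)).measurableEmbedding g
  have hi1 : IntegrableOn g (closedBall w r) μ := hgc.continuousOn.integrableOn_compact hK
  have hi2 : IntegrableOn (fun v => g (w + w - v)) (closedBall w r) μ :=
    (hgc.comp (by fun_prop)).continuousOn.integrableOn_compact hK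
  have hle : ∫ _ in closedBall w r, 2 * g w ∂μ
      ≤ ∫ v in closedBall w r, (g v + g (w + w - v)) ∂μ := by
    refine setIntegral_mono (integrableOn_const hK.measure_lt_top.ne) (hi1.add hi2) fun v => ?_
    have h := hg.2 (Set.mem_univ v) (Set.mem_univ (w + w - v)) 
      (by norm_num : (0 : ℝ) ≤ 1 / 2) (by norm_num : (0 : ℝ) ≤ 1 / 2) (by norm_num)
    have e : (1 / 2 : ℝ) • v + (1 / 2 : ℝ) • (w + w - v) = w := by module
    rw [e, smul_eq_mul, smul_eq_mul] at h
    linarith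
  rw [integral_add hi1 hi2, hrefl, setIntegral_const, smul_eq_mul] at hle
  linarith

theorem unitCube_eq_image (d : ℕ) :
    unitCube d = WithLp.toLp 2 '' Set.Icc (0 : Fin d → ℝ) 1 := by
  ext t
  simp only [unitCube, Set.mem_ofPred_eq, Set.mem_image, Set.mem_Icc, Pi.le_def]
  constructor
  · intro h
    exact ⟨t.ofLp, ⟨fun i => (h i).1, fun i => (h i).2⟩, rfl⟩
  · rintro ⟨x, ⟨h0, h1⟩, rfl⟩ i
    exact ⟨h0 i, h1 i⟩

theorem isCompact_unitCube (d : ℕ) : IsCompact (unitCube d) := by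
  rw [unitCube_eq_image]
  exact isCompact_Icc.image (PiLp.continuous_toLp 2 _)

theorem measurableSet_unitCube (d : ℕ) : MeasurableSet (unitCube d) :=
  (isCompact_unitCube d).isClosed.measurableSet

theorem zero_mem_unitCube (d : ℕ) : (0 : EuclideanSpace ℝ (Fin d)) ∈ unitCube d := by
  simp [unitCube]

theorem convex_unitCube (d : ℕ) : Convex ℝ (unitCube d) := by
  rw [unitCube_eq_image]
  exact (convex_Icc (0 : Fin d → ℝ) 1).is_linear_image
    (WithLp.linearEquiv 2 ℝ (Fin d → ℝ)).symm.toLinearMap.isLinear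

theorem volume_unitCube (d : ℕ) : volume (unitCube d) = 1 := by
  have h : unitCube d = WithLp.ofLp ⁻¹' Set.Icc (0 : Fin d → ℝ) 1 := by
    ext t
    simp [unitCube, Set.mem_Icc, Pi.le_def, forall_and]
  rw [h, (PiLp.volume_preserving_ofLp (Fin d)).measure_preimage
    measurableSet_Icc.nullMeasurableSet, Real.volume_Icc_pi]
  simp

instance isProbabilityMeasure_uniformCube (d : ℕ) : IsProbabilityMeasure (uniformCube d) :=
  ⟨by rw [uniformCube, Measure.restrict_apply_univ, volume_unitCube]⟩

theorem ae_mem_unitCube (d : ℕ) : ∀ᵐ t ∂(uniformCube d), t ∈ unitCube d :=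
  ae_restrict_mem (measurableSet_unitCube d)

theorem uniformCube_ball_pos {d : ℕ} {c : EuclideanSpace ℝ (Fin d)} (hc : c ∈ unitCube d)
    {δ : ℝ} (hδ : 0 < δ) : 0 < uniformCube d (ball c δ) := by
  have hsub : {t : EuclideanSpace ℝ (Fin d) | ∀ i, 0 < t i ∧ t i < 1} ⊆ interior (unitCube d) := by
    refine interior_maximal (fun t ht i => ⟨(ht i).1.le, (ht i).2.le⟩) ?_
    have : {t : EuclideanSpace ℝ (Fin d) | ∀ i, 0 < t i ∧ t i < 1}
        = ⋂ i, {t | 0 < t i ∧ t i < 1} := by ext; simp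
    rw [this]
    refine isOpen_iInter_of_finite fun i => ?_
    have hi : Continuous fun t : EuclideanSpace ℝ (Fin d) => t i := by fun_prop
    exact (isOpen_lt continuous_const hi).inter (isOpen_lt hi continuous_const)
  have hne : (interior (unitCube d)).Nonempty :=
    ⟨WithLp.toLp 2 fun _ => 1 / 2, hsub fun i => by norm_num⟩
  have hcl : c ∈ closure (interior (unitCube d)) := by
    rw [(convex_unitCube d).closure_interior_eq_closure_of_nonempty_interior hne]
    exact subset_closure hc
  obtain ⟨y, hy1, hy2⟩ := mem_closure_iff.1 hcl (ball c δ) isOpen_ball (mem_ball_self hδ)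
  rw [uniformCube, Measure.restrict_apply measurableSet_ball]
  refine lt_of_lt_of_le ((isOpen_ball.inter isOpen_interior).measure_pos volume ⟨y, hy1, hy2⟩)
    (measure_mono (Set.inter_subset_inter_right _ interior_subset))

theorem ContinuousOn.integrable_uniformCube {d : ℕ} {F : Type*} [NormedAddCommGroup F]
    {φ : EuclideanSpace ℝ (Fin d) → F} (h : ContinuousOn φ (unitCube d)) :
    Integrable φ (uniformCube d) :=
  h.integrableOn_compact (isCompact_unitCube d)

/-- The smallest `ψ` for which `(ψ, φ, b)` satisfies the dual constraint. -/
noncomputable def dualTransform {N d : ℕ} (φ : EuclideanSpace ℝ (Fin d) → ℝ)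
    (b : EuclideanSpace ℝ (Fin d) → EuclideanSpace ℝ (Fin N))
    (z : EuclideanSpace ℝ (Fin N) × EuclideanSpace ℝ (Fin d)) : ℝ :=
  ⨆ t : unitCube d, (inner ℝ t.1 z.2 - φ t - inner ℝ (b t) z.1)

section DualTransform

variable {N d : ℕ} {φ : EuclideanSpace ℝ (Fin d) → ℝ}
  {b : EuclideanSpace ℝ (Fin d) → EuclideanSpace ℝ (Fin N)}

theorem continuousOn_dualTransform_integrand (hφ : ContinuousOn φ (unitCube d))
    (hb : ContinuousOn b (unitCube d)) (z : EuclideanSpace ℝ (Fin N) × EuclideanSpace ℝ (Fin d)) :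
    ContinuousOn (fun t => inner ℝ t z.2 - φ t - inner ℝ (b t) z.1) (unitCube d) := by
  fun_prop

theorem bddAbove_dualTransform (hφ : ContinuousOn φ (unitCube d))
    (hb : ContinuousOn b (unitCube d)) (z : EuclideanSpace ℝ (Fin N) × EuclideanSpace ℝ (Fin d)) :
    BddAbove (Set.range fun t : unitCube d => inner ℝ t.1 z.2 - φ t - inner ℝ (b t) z.1) := by
  have := (isCompact_unitCube d).bddAbove_image (continuousOn_dualTransform_integrand hφ hb z)
  rwa [Set.image_eq_range] at this

theorem le_dualTransform (hφ : ContinuousOn φ (unitCube d)) (hb : ContinuousOn b (unitCube d))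
    (z : EuclideanSpace ℝ (Fin N) × EuclideanSpace ℝ (Fin d)) {t : EuclideanSpace ℝ (Fin d)}
    (ht : t ∈ unitCube d) :
    inner ℝ t z.2 ≤ dualTransform φ b z + (φ t + inner ℝ (b t) z.1) := by
  have := le_ciSup (bddAbove_dualTransform hφ hb z) ⟨t, ht⟩
  simp only at this
  unfold dualTransform
  linarith

theorem dualTransform_le {z : EuclideanSpace ℝ (Fin N) × EuclideanSpace ℝ (Fin d)} {r : ℝ}
    (h : ∀ t ∈ unitCube d, inner ℝ t z.2 ≤ r + (φ t + inner ℝ (b t) z.1)) :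
    dualTransform φ b z ≤ r := by
  have : Nonempty (unitCube d) := ⟨⟨0, zero_mem_unitCube d⟩⟩
  exact ciSup_le fun t => by have := h t t.2; linarith

theorem exists_dualTransform_eq (hφ : ContinuousOn φ (unitCube d))
    (hb : ContinuousOn b (unitCube d)) (z : EuclideanSpace ℝ (Fin N) × EuclideanSpace ℝ (Fin d)) :
    ∃ t ∈ unitCube d, dualTransform φ b z = inner ℝ t z.2 - φ t - inner ℝ (b t) z.1 := by
  obtain ⟨t, ht, hmax⟩ := (isCompact_unitCube d).exists_isMaxOn ⟨0, zero_mem_unitCube d⟩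
    (continuousOn_dualTransform_integrand hφ hb z)
  refine ⟨t, ht, le_antisymm (dualTransform_le fun s hs => ?_) ?_⟩
  · have := hmax hs
    simp only [Set.mem_ofPred_eq] at this
    linarith
  · have := le_dualTransform hφ hb z ht
    linarith

theorem convexOn_dualTransform (hφ : ContinuousOn φ (unitCube d))
    (hb : ContinuousOn b (unitCube d)) :
    ConvexOn ℝ Set.univ (dualTransform (N := N) φ b) := by
  refine ⟨convex_univ, fun z _ w _ p q hp hq hpq => dualTransform_le fun t ht => ?_⟩
  have h1 := mul_le_mul_of_nonneg_left (le_dualTransform hφ hb z ht) hp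
  have h2 := mul_le_mul_of_nonneg_left (le_dualTransform hφ hb w ht) hq
  simp only [Prod.snd_add, Prod.smul_snd, Prod.fst_add, Prod.smul_fst, inner_add_right,
    inner_smul_right, smul_eq_mul]
  have e : φ t = p * φ t + q * φ t := by rw [← add_mul, hpq, one_mul]
  rw [e]
  linarith

theorem continuous_dualTransform (hφ : ContinuousOn φ (unitCube d))
    (hb : ContinuousOn b (unitCube d)) : Continuous (dualTransform (N := N) φ b) :=
  (convexOn_dualTransform hφ hb).locallyLipschitz.continuous

end DualTransform

theorem ae_mem_support {N d : ℕ}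
    (ν : Measure (EuclideanSpace ℝ (Fin N) × EuclideanSpace ℝ (Fin d))) :
    ∀ᵐ z ∂ν, z ∈ ν.support :=
  Measure.support_mem_ae

theorem ContinuousOn.integrable_of_isCompact_support {N d : ℕ}
    {ν : Measure (EuclideanSpace ℝ (Fin N) × EuclideanSpace ℝ (Fin d))} [IsFiniteMeasure ν]
    (hν : IsCompact ν.support) {F : Type*} [NormedAddCommGroup F]
    {g : EuclideanSpace ℝ (Fin N) × EuclideanSpace ℝ (Fin d) → F}
    (hg : ContinuousOn g ν.support) : Integrable g ν := by
  have := hg.integrableOn_compact (μ := ν) hν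
  rwa [IntegrableOn, Measure.restrict_eq_self_of_ae_mem (ae_mem_support ν)] at this

/-- A continuous partition of unity on the cube, subordinate to balls of radius `δ`. -/
theorem exists_partition_unitCube (d : ℕ) {δ : ℝ} (hδ : 0 < δ) :
    ∃ (s : Finset (EuclideanSpace ℝ (Fin d)))
      (h : EuclideanSpace ℝ (Fin d) → EuclideanSpace ℝ (Fin d) → ℝ),
      (∀ c ∈ s, ContinuousOn (h c) (unitCube d)) ∧ (∀ c t, 0 ≤ h c t) ∧
      (∀ t ∈ unitCube d, ∑ c ∈ s, h c t = 1) ∧ (∀ c t, h c t ≠ 0 → dist t c < δ) ∧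
      ∀ c ∈ s, 0 < ∫ t, h c t ∂(uniformCube d) := by
  obtain ⟨s, hs, hcov⟩ := (isCompact_unitCube d).elim_nhds_subcover (fun c => ball c δ)
    fun c _ => ball_mem_nhds c hδ
  set u : EuclideanSpace ℝ (Fin d) → EuclideanSpace ℝ (Fin d) → ℝ :=
    fun c t => max 0 (δ - dist t c) with hu
  have hu0 : ∀ c t, 0 ≤ u c t := fun c t => le_max_left _ _
  have huc : ∀ c, Continuous (u c) := fun c => by simp only [hu]; fun_prop
  have hupos : ∀ c t, dist t c < δ → 0 < u c t := fun c t h =>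
    lt_max_of_lt_right (by linarith)
  have hS : ∀ t ∈ unitCube d, 0 < ∑ c ∈ s, u c t := fun t ht => by
    obtain ⟨c, hc, htc⟩ := Set.mem_iUnion₂.1 (hcov ht)
    exact Finset.sum_pos' (fun c _ => hu0 c t) ⟨c, hc, hupos c t htc⟩
  have hcont : ∀ c ∈ s, ContinuousOn (fun t => u c t / ∑ c ∈ s, u c t) (unitCube d) := fun c _ =>
    (huc c).continuousOn.div (continuous_finsetSum s fun c _ => huc c).continuousOn
      fun t ht => (hS t ht).ne'
  have hnn : ∀ c t, 0 ≤ u c t / ∑ c ∈ s, u c t := fun c t =>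
    div_nonneg (hu0 c t) (Finset.sum_nonneg fun c _ => hu0 c t)
  refine ⟨s, fun c t => u c t / ∑ c ∈ s, u c t, hcont, hnn, ?_, ?_, ?_⟩
  · intro t ht
    rw [← Finset.sum_div, div_self (hS t ht).ne']
  · intro c t h
    by_contra hd
    refine h ?_
    have : u c t = 0 := max_eq_left (by linarith)
    simp only [this, zero_div]
  · intro c hc
    rw [integral_pos_iff_support_of_nonneg (hnn c) (hcont c hc).integrable_uniformCube]
    refine (uniformCube_ball_pos (hs c hc) hδ).trans_le (measure_mono_ae ?_)
    filter_upwards [ae_mem_unitCube d] with t ht htb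
    exact (div_pos (hupos c t htb) (hS t ht)).ne'

/-- Admissible `L¹` triples can be smoothed to continuous admissible triples, with an arbitrarily
small increase of the cost. -/
theorem exists_continuousDualValues_le {N d : ℕ}
    {ν : Measure (EuclideanSpace ℝ (Fin N) × EuclideanSpace ℝ (Fin d))} [IsProbabilityMeasure ν]
    (hν : IsCompact ν.support) {ψ : EuclideanSpace ℝ (Fin N) × EuclideanSpace ℝ (Fin d) → EReal}
    {φ : EuclideanSpace ℝ (Fin d) → ℝ} {b : EuclideanSpace ℝ (Fin d) → EuclideanSpace ℝ (Fin N)}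
    (h : IsL1Admissible ν ψ φ b) {ε : ℝ} (hε : 0 < ε) :
    ∃ c ∈ continuousDualValues ν, c ≤ dualCost ν ψ φ + ε := by
  obtain ⟨R, hR0, hR⟩ := hν.isBounded.exists_pos_norm_le
  obtain ⟨s, w, hwc, hw0, hw1, hwd, hwi⟩ :=
    exists_partition_unitCube d (δ := ε / (2 * R)) (by positivity)
  set m := fun c => ∫ t, w c t ∂(uniformCube d) with hm
  have hiφ : ∀ c ∈ s, Integrable (fun t => w c t * φ t) (uniformCube d) := fun c hc =>
    IntegrableOn.continuousOn_mul (hwc c hc) h.integrable_phi (isCompact_unitCube d)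
  have hib : ∀ c ∈ s, Integrable (fun t => w c t • b t) (uniformCube d) := fun c hc =>
    IntegrableOn.continuousOn_smul h.integrable_b (hwc c hc) (isCompact_unitCube d)
  have hiw : ∀ c ∈ s, Integrable (w c) (uniformCube d) := fun c hc =>
    (hwc c hc).integrable_uniformCube
  set φ' := fun t => ∑ c ∈ s, w c t * ((∫ r, w c r * φ r ∂(uniformCube d)) / m c) with hφ'
  set b' := fun t => ∑ c ∈ s, w c t • ((m c)⁻¹ • ∫ r, w c r • b r ∂(uniformCube d)) with hb'
  have hφ'c : ContinuousOn φ' (unitCube d) :=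
    continuousOn_finsetSum s fun c hc => (hwc c hc).mul continuousOn_const
  have hb'c : ContinuousOn b' (unitCube d) :=
    continuousOn_finsetSum s fun c hc => (hwc c hc).smul continuousOn_const
  have hφint : ∫ t, φ' t ∂(uniformCube d) = ∫ t, φ t ∂(uniformCube d) := by
    rw [hφ', integral_finsetSum _ fun c hc => (hiw c hc).mul_const _]
    simp_rw [integral_mul_const]
    calc ∑ c ∈ s, m c * ((∫ r, w c r * φ r ∂(uniformCube d)) / m c)
        = ∑ c ∈ s, ∫ r, w c r * φ r ∂(uniformCube d) :=
          Finset.sum_congr rfl fun c hc => mul_div_cancel₀ _ (hwi c hc).ne'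
      _ = ∫ r, ∑ c ∈ s, w c r * φ r ∂(uniformCube d) := (integral_finsetSum _ hiφ).symm
      _ = ∫ t, φ t ∂(uniformCube d) := by
          refine integral_congr_ae ?_
          filter_upwards [ae_mem_unitCube d] with t ht
          rw [← Finset.sum_mul, hw1 t ht, one_mul]
  have key : ∀ z ∈ ν.support, ψ z ≠ ⊤ → ψ z ≠ ⊥ → ∀ t ∈ unitCube d,
      inner ℝ t z.2 ≤ ((ψ z).toReal + ε) + (φ' t + inner ℝ (b' t) z.1) := by
    intro z hz htop hbot t ht
    set p := (ψ z).toReal with hp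
    have hcon : ∀ r ∈ unitCube d, inner ℝ r z.2 ≤ p + (φ r + inner ℝ (b r) z.1) := fun r hr => by
      have := h.constraint z hz r hr
      rw [← EReal.coe_toReal htop hbot] at this
      exact_mod_cast this
    have hz2 : ‖z.2‖ ≤ R := (norm_snd_le z).trans (hR z hz)
    have hcell : ∀ c ∈ s, w c t * (inner ℝ t z.2 - ε - p) ≤
        w c t * ((∫ r, w c r * φ r ∂(uniformCube d)) / m c
          + inner ℝ ((m c)⁻¹ • ∫ r, w c r • b r ∂(uniformCube d)) z.1) := by
      intro c hc
      by_cases hct : w c t = 0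
      · simp [hct]
      refine mul_le_mul_of_nonneg_left ?_ (hw0 c t)
      have hint : ∫ r, w c r * (inner ℝ t z.2 - ε - p) ∂(uniformCube d)
          ≤ ∫ r, (w c r * φ r + inner ℝ (w c r • b r) z.1) ∂(uniformCube d) := by
        refine integral_mono_ae ((hiw c hc).mul_const _)
          ((hiφ c hc).add ((hib c hc).inner_const z.1)) ?_
        filter_upwards [ae_mem_unitCube d] with r hr
        by_cases hcr : w c r = 0
        · simp [hcr]
        have hd : ‖t - r‖ ≤ ε / R := by
          rw [← dist_eq_norm]
          have h1 := hwd c t hct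
          have h2 := hwd c r hcr
          have h3 := dist_triangle_right t r c
          have h4 : ε / (2 * R) + ε / (2 * R) = ε / R := by field_simp; norm_num
          linarith
        have h5 : inner ℝ (t - r) z.2 ≤ ε := by
          calc inner ℝ (t - r) z.2 ≤ ‖t - r‖ * ‖z.2‖ := real_inner_le_norm _ _
            _ ≤ ε / R * R := by gcongr
            _ = ε := by field_simp
        rw [inner_sub_left] at h5
        have h6 := hcon r hr
        simp only [inner_smul_left, RCLike.conj_to_real, ← mul_add]
        exact mul_le_mul_of_nonneg_left (by linarith) (hw0 c r)
      have hin : ∫ r, inner ℝ (w c r • b r) z.1 ∂(uniformCube d)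
          = inner ℝ (∫ r, w c r • b r ∂(uniformCube d)) z.1 := by
        simp_rw [real_inner_comm z.1]
        exact integral_inner (hib c hc) z.1
      rw [integral_mul_const, integral_add (hiφ c hc) ((hib c hc).inner_const z.1), hin] at hint
      rw [inner_smul_left, RCLike.conj_to_real, inv_mul_eq_div, ← add_div,
        le_div_iff₀ (hwi c hc), mul_comm]
      exact hint
    have hsum := Finset.sum_le_sum hcell
    rw [← Finset.sum_mul, hw1 t ht, one_mul] at hsum
    simp only [mul_add, Finset.sum_add_distrib] at hsum
    have hbi : inner ℝ (b' t) z.1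
        = ∑ c ∈ s, w c t * inner ℝ ((m c)⁻¹ • ∫ r, w c r • b r ∂(uniformCube d)) z.1 := by
      simp only [hb', sum_inner]
      exact Finset.sum_congr rfl fun c _ => by rw [inner_smul_left, RCLike.conj_to_real]
    rw [hbi]
    linarith
  have hψ'c := continuous_dualTransform (N := N) hφ'c hb'c
  refine ⟨_, ⟨dualTransform φ' b', φ', b', hψ'c.continuousOn, hφ'c, hb'c, ?_, rfl⟩, ?_⟩
  · intro z _ t ht
    simp only [← EReal.coe_add, EReal.coe_le_coe_iff]
    exact le_dualTransform hφ'c hb'c z ht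
  · have hle : ∫ z, dualTransform φ' b' z ∂ν ≤ ∫ z, ((ψ z).toReal + ε) ∂ν := by
      refine integral_mono_ae (hψ'c.continuousOn.integrable_of_isCompact_support hν)
        (h.integrable_psi.add (integrable_const ε)) ?_
      filter_upwards [h.ae_finite, ae_mem_support ν] with z hz hzs
      exact dualTransform_le (key z hzs hz.1 hz.2)
    rw [integral_add h.integrable_psi (integrable_const ε)] at hle
    simp only [integral_const, probReal_univ, smul_eq_mul, one_mul] at hle
    simp only [dualCost, EReal.toReal_coe, hφint]
    linarith

/-- Subtracting an affine function of `x` normalizes a continuous admissible triple, so that both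
potentials are bounded below by a constant depending only on the support. -/
theorem exists_normalized_triple {N d : ℕ}
    {ν : Measure (EuclideanSpace ℝ (Fin N) × EuclideanSpace ℝ (Fin d))} [IsProbabilityMeasure ν]
    (hν : IsCompact ν.support) (hcentered : ∫ z, z.1 ∂ν = 0)
    {m : EuclideanSpace ℝ (Fin N) × EuclideanSpace ℝ (Fin d)} (hm : m ∈ ν.support)
    (hm1 : m.1 = 0) {R D : ℝ} (hR : ∀ z ∈ ν.support, ‖z‖ ≤ R) (hD : ∀ t ∈ unitCube d, ‖t‖ ≤ D)
    {c : ℝ} (hc : c ∈ continuousDualValues ν) :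
    ∃ (g : EuclideanSpace ℝ (Fin N) × EuclideanSpace ℝ (Fin d) → ℝ)
      (φ : EuclideanSpace ℝ (Fin d) → ℝ) (b : EuclideanSpace ℝ (Fin d) → EuclideanSpace ℝ (Fin N)),
      ConvexOn ℝ Set.univ g ∧ (∀ z ∈ ν.support, -(2 * D * R) ≤ g z) ∧
      ContinuousOn φ (unitCube d) ∧ (∀ t ∈ unitCube d, -(2 * D * R) ≤ φ t) ∧
      (∀ z ∈ ν.support, ∀ t ∈ unitCube d, inner ℝ t z.2 ≤ g z + (φ t + inner ℝ (b t) z.1)) ∧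
      (∫ z, g z ∂ν) + ∫ t, φ t ∂(uniformCube d) ≤ c := by
  obtain ⟨ψ, φ, b, hψ, hφ, hb, hcon, rfl⟩ := hc
  have hD0 : 0 ≤ D := by simpa using hD 0 (zero_mem_unitCube d)
  have hR0 : 0 ≤ R := (norm_nonneg m).trans (hR m hm)
  obtain ⟨t₀, ht₀, hT⟩ := exists_dualTransform_eq hφ hb m
  set T := dualTransform φ b with hTdef
  have hTconv : ConvexOn ℝ Set.univ T := convexOn_dualTransform hφ hb
  have hTc : Continuous T := continuous_dualTransform hφ hb
  have hTle : ∀ z (t : EuclideanSpace ℝ (Fin d)), t ∈ unitCube d →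
    inner ℝ t z.2 ≤ T z + (φ t + inner ℝ (b t) z.1) := fun z t ht => le_dualTransform hφ hb z ht
  have hin : ∀ z ∈ ν.support, ∀ t ∈ unitCube d, |inner ℝ t z.2| ≤ D * R := fun z hz t ht =>
    (abs_real_inner_le_norm _ _).trans
      (mul_le_mul (hD t ht) ((norm_snd_le z).trans (hR z hz)) (norm_nonneg _) hD0)
  have hDR : 0 ≤ D * R := mul_nonneg hD0 hR0
  rw [hm1, inner_zero_right] at hT
  have hTint : Integrable T ν := hTc.continuousOn.integrable_of_isCompact_support hν
  have hfst : Integrable (fun z => z.1) ν :=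
    continuous_fst.continuousOn.integrable_of_isCompact_support hν
  refine ⟨fun z => T z + (inner ℝ (b t₀) z.1 - T m), fun t => φ t + T m,
    fun t => b t - b t₀, ?_, ?_, hφ.add continuousOn_const, ?_, ?_, ?_⟩
  · refine hTconv.add ⟨convex_univ, fun z _ w _ p q _ _ hpq => le_of_eq ?_⟩
    simp only [Prod.fst_add, Prod.smul_fst, inner_add_right, inner_smul_right, smul_eq_mul]
    have e : T m = p * T m + q * T m := by rw [← add_mul, hpq, one_mul]
    linarith
  · intro z hz
    have h1 := hTle z t₀ ht₀
    have h2 := abs_le.1 (hin z hz t₀ ht₀)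
    have h3 := abs_le.1 (hin m hm t₀ ht₀)
    linarith [h2.1, h3.2]
  · intro t ht
    have h1 := hTle m t ht
    rw [hm1, inner_zero_right] at h1
    have h3 := abs_le.1 (hin m hm t ht)
    linarith [h3.1]
  · intro z hz t ht
    have h1 := hTle z t ht
    rw [inner_sub_left]
    linarith
  · have hle : ∫ z, T z ∂ν ≤ ∫ z, ψ z ∂ν := by
      refine integral_mono_ae hTint (hψ.integrable_of_isCompact_support hν) ?_
      filter_upwards [ae_mem_support ν] with z hz
      refine dualTransform_le fun t ht => ?_
      have := hcon z hz t ht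
      simpa only [← EReal.coe_add, EReal.coe_le_coe_iff] using this
    have h0 : ∫ z, inner ℝ (b t₀) z.1 ∂ν = 0 := by
      rw [integral_inner hfst, hcentered, inner_zero_right]
    have h1 : ∫ z, (T z + (inner ℝ (b t₀) z.1 - T m)) ∂ν = (∫ z, T z ∂ν) - T m := by
      have hi : Integrable (fun z => inner ℝ (b t₀) z.1 - T m) ν :=
        (hfst.const_inner _).sub (integrable_const _)
      rw [integral_add hTint hi, integral_sub (hfst.const_inner _) (integrable_const _), h0]
      simp [sub_eq_add_neg]
    have h2 : ∫ t, (φ t + T m) ∂(uniformCube d) = (∫ t, φ t ∂(uniformCube d)) + T m := by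
      rw [integral_add hφ.integrable_uniformCube (integrable_const _)]
      simp
    simp only [dualCost, EReal.toReal_coe, h1, h2]
    linarith

/-- Convex functions with bounded integrals against a density which is bounded below on compact
sets are locally bounded above. -/
theorem exists_ball_le_of_integral_le {E : Type*} [NormedAddCommGroup E] [NormedSpace ℝ E]
    [FiniteDimensional ℝ E] [MeasureSpace E] [BorelSpace E] [(volume : Measure E).IsAddHaarMeasure]
    {Ω : Set E} (hopen : IsOpen Ω) {f : E → ℝ} {ν : Measure E} [IsProbabilityMeasure ν]
    (hν : ν = (volume.restrict Ω).withDensity (fun z => ENNReal.ofReal (f z)))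
    (hlow : ∀ K : Set E, IsCompact K → K ⊆ Ω →
      ∃ α : ℝ, 0 < α ∧ ∀ᵐ z ∂(volume.restrict K), α ≤ f z)
    {z : E} (hz : z ∈ Ω) (C M : ℝ) :
    ∃ r > 0, ∃ B, ball z r ⊆ Ω ∧ ∀ g : E → ℝ, ConvexOn ℝ Set.univ g → (∀ w ∈ Ω, -C ≤ g w) →
      Integrable g ν → ∫ w, g w ∂ν ≤ M → ∀ w ∈ ball z r, g w ≤ B := by
  have : ProperSpace E := FiniteDimensional.proper ℝ E
  obtain ⟨r, hr, hrΩ⟩ := nhds_basis_closedBall.mem_iff.1 (hopen.mem_nhds hz)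
  obtain ⟨α, hα, hαf⟩ := hlow _ (isCompact_closedBall z r) hrΩ
  set V := volume.real (closedBall (0 : E) (r / 2)) with hV
  have hVpos : 0 < V := ENNReal.toReal_pos (measure_closedBall_pos _ _ (by positivity)).ne'
    (isCompact_closedBall _ _).measure_lt_top.ne
  have hmeas : ENNReal.ofReal α • (volume.restrict (closedBall z r)) ≤ ν := by
    refine Measure.le_iff.2 fun A hA => ?_
    calc (ENNReal.ofReal α • (volume.restrict (closedBall z r))) A
        = ∫⁻ _ in A ∩ closedBall z r, ENNReal.ofReal α := by
          rw [setLIntegral_const, Measure.smul_apply, Measure.restrict_apply hA, smul_eq_mul]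
      _ ≤ ∫⁻ w in A ∩ closedBall z r, ENNReal.ofReal (f w) := by
          refine lintegral_mono_ae ?_
          filter_upwards [ae_restrict_of_ae_restrict_of_subset Set.inter_subset_right hαf] with w hw
          exact ENNReal.ofReal_le_ofReal hw
      _ ≤ ∫⁻ w in A ∩ Ω, ENNReal.ofReal (f w) :=
          lintegral_mono_set (Set.inter_subset_inter_right _ hrΩ)
      _ = ν A := by
          rw [hν, withDensity_apply _ hA, Measure.restrict_restrict hA]
  have hΩ : ∀ᵐ w ∂ν, w ∈ Ω := by
    rw [hν]
    exact (withDensity_absolutelyContinuous _ _).ae_le (ae_restrict_mem hopen.measurableSet)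
  refine ⟨r / 2, by positivity, (M + C) / α / V - C, ?_, ?_⟩
  · exact (ball_subset_closedBall.trans (closedBall_subset_closedBall (by linarith))).trans hrΩ
  intro g hg hgC hgi hgM w hw
  have hgc : Continuous g := hg.locallyLipschitz.continuous
  have hsub : closedBall w (r / 2) ⊆ closedBall z r :=
    closedBall_subset_closedBall' (by linarith [mem_ball.1 hw])
  have hgCconv : ConvexOn ℝ Set.univ fun v => g v + C := hg.add (convexOn_const C convex_univ)
  have h1 := hgCconv.mul_measure_closedBall_le volume w (r / 2)
  have hVw : volume.real (closedBall w (r / 2)) = V := by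
    rw [hV, Measure.real, Measure.real, Measure.addHaar_closedBall_center]
  rw [hVw] at h1
  have hKi : IntegrableOn (fun v => g v + C) (closedBall z r) volume :=
    (hgc.add continuous_const).continuousOn.integrableOn_compact (isCompact_closedBall _ _)
  have h2 : ∫ v in closedBall w (r / 2), (g v + C) ≤ ∫ v in closedBall z r, (g v + C) := by
    refine setIntegral_mono_set hKi ?_ (Eventually.of_forall hsub)
    filter_upwards [ae_restrict_mem measurableSet_closedBall] with v hv
    have := hgC v (hrΩ hv)
    simp only [Pi.zero_apply]
    linarith
  have h3 : α * ∫ v in closedBall z r, (g v + C) ≤ ∫ v, (g v + C) ∂ν := by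
    have h := integral_mono_measure (f := fun v => g v + C) hmeas ?_
      (hgi.add (integrable_const C))
    · rwa [integral_smul_measure, ENNReal.toReal_ofReal hα.le, smul_eq_mul] at h
    · filter_upwards [hΩ] with v hv
      have := hgC v hv
      simp only [Pi.zero_apply]
      linarith
  rw [integral_add hgi (integrable_const C)] at h3
  simp only [integral_const, probReal_univ, smul_eq_mul, one_mul] at h3
  have h4 : (g w + C) * V ≤ (M + C) / α := by
    rw [le_div_iff₀ hα]
    nlinarith
  rw [le_sub_iff_add_le, le_div_iff₀ hVpos]
  exact h4

/-- A locally uniformly bounded sequence of convex functions has a subsequence which converges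
pointwise. -/
theorem exists_subseq_tendsto_of_convexOn {E : Type*} [NormedAddCommGroup E] [NormedSpace ℝ E]
    [TopologicalSpace.SeparableSpace E] {Ω : Set E} {g : ℕ → E → ℝ}
    (hconv : ∀ n, ConvexOn ℝ Set.univ (g n))
    (hbd : ∀ z ∈ Ω, ∃ r > 0, ∃ B, ∀ n, ∀ w ∈ ball z r, |g n w| ≤ B) :
    ∃ k : ℕ → ℕ, StrictMono k ∧ ∃ G : E → ℝ,
      ∀ z ∈ Ω, Tendsto (fun n => g (k n) z) atTop (𝓝 (G z)) := by
  obtain ⟨Q, hQΩ, hQc, hQ⟩ :=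
    (TopologicalSpace.IsSeparable.of_separableSpace Ω).exists_countable_dense_subset
  have : Countable Q := hQc
  have hbQ : ∀ q : Q, ∃ B, ∀ n, |g n q| ≤ B := fun q => by
    obtain ⟨r, hr, B, hB⟩ := hbd q (hQΩ q.2)
    exact ⟨B, fun n => hB n q (mem_ball_self hr)⟩
  choose B hB using hbQ
  have hcomp : IsCompact (Set.univ.pi fun q : Q => Set.Icc (-B q) (B q)) :=
    isCompact_univ_pi fun q => isCompact_Icc
  obtain ⟨x, -, k, hk, hx⟩ := hcomp.tendsto_subseq (x := fun n (q : Q) => g n q)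
    fun n q _ => abs_le.1 (hB q n)
  rw [tendsto_pi_nhds] at hx
  refine ⟨k, hk, ?_⟩
  have hlim : ∀ z ∈ Ω, ∃ l, Tendsto (fun n => g (k n) z) atTop (𝓝 l) := by
    intro z hz
    obtain ⟨r, hr, B', hB'⟩ := hbd z hz
    have hlip : ∀ n, LipschitzOnWith (2 * B' / (r / 2)).toNNReal (g n) (ball z (r - r / 2)) :=
      fun n => ((hconv n).subset (Set.subset_univ _) (convex_ball z r)).lipschitzOnWith_of_abs_le
        (by positivity) fun a ha => hB' n a ha
    set L : ℝ := ((2 * B' / (r / 2)).toNNReal : ℝ) with hL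
    have hL0 : 0 ≤ L := NNReal.coe_nonneg _
    refine cauchySeq_tendsto_of_complete (Metric.cauchySeq_iff.2 fun ε hε => ?_)
    have hρ : 0 < min (r - r / 2) (ε / (4 * (L + 1))) :=
      lt_min (by linarith) (by positivity)
    obtain ⟨q, hqz, hqQ⟩ := mem_closure_iff.1 (hQ hz) _ isOpen_ball (mem_ball_self hρ)
    have hqd : dist q z < ε / (4 * (L + 1)) := (mem_ball.1 hqz).trans_le (min_le_right _ _)
    have hq : ∀ n, dist (g n z) (g n q) ≤ ε / 4 := fun n => by
      have h1 := (hlip n).dist_le_mul z (mem_ball_self (by linarith)) q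
        (mem_ball.2 ((mem_ball.1 hqz).trans_le (min_le_left _ _)))
      rw [dist_comm z q] at h1
      calc dist (g n z) (g n q) ≤ L * dist q z := h1
        _ ≤ (L + 1) * (ε / (4 * (L + 1))) := by gcongr; linarith
        _ = ε / 4 := by field_simp
    obtain ⟨n₀, hn₀⟩ := Metric.cauchySeq_iff.1 (hx ⟨q, hqQ⟩).cauchySeq (ε / 4) (by positivity)
    refine ⟨n₀, fun i hi j hj => ?_⟩
    have h1 := hn₀ i hi j hj
    simp only [Function.comp_apply] at h1
    have h2 := hq (k i)
    have h3 := hq (k j)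
    rw [dist_comm] at h3
    have h4 := dist_triangle4 (g (k i) z) (g (k i) q) (g (k j) q) (g (k j) z)
    linarith
  choose! G hG using hlim
  exact ⟨G, hG⟩

section Multiplier

variable {N d : ℕ} {g : EuclideanSpace ℝ (Fin N) × EuclideanSpace ℝ (Fin d) → ℝ}
  {Ω : Set (EuclideanSpace ℝ (Fin N) × EuclideanSpace ℝ (Fin d))}
  {m : EuclideanSpace ℝ (Fin N) × EuclideanSpace ℝ (Fin d)} {R C B r : ℝ}

theorem mul_norm_le_of_constraint (hr : 0 < r) (hm1 : m.1 = 0) (hm2 : ‖m.2‖ ≤ R)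
    (hB : ∀ z ∈ ball m r, g z ≤ B) {t : EuclideanSpace ℝ (Fin d)} {β : EuclideanSpace ℝ (Fin N)}
    {p : ℝ} (h : ∀ z ∈ ball m r, inner ℝ t z.2 ≤ g z + (p + inner ℝ β z.1)) :
    r / 2 * ‖β‖ ≤ p + B + ‖t‖ * R := by
  have hmem : ((-(r / 2 * ‖β‖⁻¹)) • β, m.2) ∈ ball m r := by
    rw [mem_ball, Prod.dist_eq, max_lt_iff, dist_self, hm1, dist_zero_right, norm_smul, norm_neg,
      Real.norm_of_nonneg (by positivity), mul_assoc]
    refine ⟨?_, hr⟩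
    have : ‖β‖⁻¹ * ‖β‖ ≤ 1 := inv_mul_le_one
    nlinarith
  have h1 := h _ hmem
  have h2 := hB _ hmem
  have h3 : inner ℝ β ((-(r / 2 * ‖β‖⁻¹)) • β) = -(r / 2 * ‖β‖) := by
    rw [inner_smul_right, real_inner_self_eq_norm_sq]
    rcases eq_or_ne ‖β‖ 0 with h0 | h0
    · simp [h0]
    · field_simp
  have h4 : -(‖t‖ * R) ≤ inner ℝ t m.2 := by
    have := (abs_le.1 (abs_real_inner_le_norm t m.2)).1
    have : ‖t‖ * ‖m.2‖ ≤ ‖t‖ * R := by gcongr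
    linarith
  rw [h3] at h1
  linarith

/-- For a given potential `g`, the optimal `φ` is continuous and is attained by a measurable
multiplier `b`. -/
theorem exists_optimal_multiplier (hR : ∀ z ∈ Ω, ‖z‖ ≤ R) (hC : ∀ z ∈ Ω, -C ≤ g z) (hr : 0 < r)
    (hrΩ : ball m r ⊆ Ω) (hm1 : m.1 = 0) (hB : ∀ z ∈ ball m r, g z ≤ B) :
    ∃ (φ : EuclideanSpace ℝ (Fin d) → ℝ) (b : EuclideanSpace ℝ (Fin d) → EuclideanSpace ℝ (Fin N)),
      Continuous φ ∧ Measurable b ∧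
      (∀ t, ∀ z ∈ Ω, inner ℝ t z.2 ≤ g z + (φ t + inner ℝ (b t) z.1)) ∧
      ∀ t β p, (∀ z ∈ Ω, inner ℝ t z.2 ≤ g z + (p + inner ℝ β z.1)) → φ t ≤ p := by
  have hm : m ∈ Ω := hrΩ (mem_ball_self hr)
  have hR0 : 0 ≤ R := (norm_nonneg m).trans (hR m hm)
  have hm2 : ‖m.2‖ ≤ R := (norm_snd_le m).trans (hR m hm)
  have : Nonempty Ω := ⟨⟨m, hm⟩⟩
  have hin1 : ∀ (β : EuclideanSpace ℝ (Fin N)), ∀ z ∈ Ω, |inner ℝ β z.1| ≤ R * ‖β‖ :=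
    fun β z hz => (abs_real_inner_le_norm _ _).trans (by
      rw [mul_comm]; gcongr; exact (norm_fst_le z).trans (hR z hz))
  have hin2 : ∀ (t : EuclideanSpace ℝ (Fin d)), ∀ z ∈ Ω, |inner ℝ t z.2| ≤ R * ‖t‖ :=
    fun t z hz => (abs_real_inner_le_norm _ _).trans (by
      rw [mul_comm]; gcongr; exact (norm_snd_le z).trans (hR z hz))
  set G : EuclideanSpace ℝ (Fin d) → EuclideanSpace ℝ (Fin N) → ℝ :=
    fun t β => ⨆ z : Ω, (inner ℝ t z.1.2 - g z - inner ℝ β z.1.1) with hG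
  have hbdd : ∀ t β, BddAbove (Set.range fun z : Ω => inner ℝ t z.1.2 - g z - inner ℝ β z.1.1) := by
    rintro t β
    refine ⟨R * ‖t‖ + C + R * ‖β‖, ?_⟩
    rintro _ ⟨z, rfl⟩
    have h1 := (abs_le.1 (hin1 β z z.2)).1
    have h2 := (abs_le.1 (hin2 t z z.2)).2
    have h3 := hC z z.2
    simp only
    linarith
  have hGle : ∀ t β, ∀ z ∈ Ω, inner ℝ t z.2 ≤ g z + (G t β + inner ℝ β z.1) := fun t β z hz => by
    have := le_ciSup (hbdd t β) ⟨z, hz⟩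
    simp only at this
    simp only [hG]
    linarith
  have hleG : ∀ t β p, (∀ z ∈ Ω, inner ℝ t z.2 ≤ g z + (p + inner ℝ β z.1)) → G t β ≤ p :=
    fun t β p h => ciSup_le fun z => by have := h z z.2; linarith
  have hlip : ∀ t s β γ, G t β ≤ G s γ + (R * dist t s + R * dist β γ) := by
    intro t s β γ
    refine hleG _ _ _ fun z hz => ?_
    have h1 := hGle s γ z hz
    have h2 := (abs_le.1 (hin2 (t - s) z hz)).2
    have h3 := (abs_le.1 (hin1 (β - γ) z hz)).1
    rw [inner_sub_left] at h2 h3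
    rw [dist_eq_norm, dist_eq_norm]
    linarith
  have hGt : ∀ t, Continuous (G t) := fun t =>
    (LipschitzWith.of_le_add_mul' R fun β γ => by simpa using hlip t t β γ).continuous
  have hGβ : ∀ β, Continuous fun t => G t β := fun β =>
    (LipschitzWith.of_le_add_mul' R fun t s => by simpa using hlip t s β β).continuous
  have hcoer : ∀ t β, r / 2 * ‖β‖ - (B + ‖t‖ * R) ≤ G t β := fun t β => by
    have := mul_norm_le_of_constraint hr hm1 hm2 hB (fun z hz => hGle t β z (hrΩ hz))
    linarith
  have hconv : ∀ t, ConvexOn ℝ Set.univ (G t) := by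
    refine fun t => ⟨convex_univ, fun β _ γ _ p q hp hq hpq => hleG _ _ _ fun z hz => ?_⟩
    have h1 := mul_le_mul_of_nonneg_left (hGle t β z hz) hp
    have h2 := mul_le_mul_of_nonneg_left (hGle t γ z hz) hq
    simp only [inner_add_left, inner_smul_left, RCLike.conj_to_real, smul_eq_mul]
    have e : inner ℝ t z.2 - g z = p * (inner ℝ t z.2 - g z) + q * (inner ℝ t z.2 - g z) := by
      rw [← add_mul, hpq, one_mul]
    linarith
  have hmin : ∀ t, ∃ β, ∀ γ, G t β ≤ G t γ := fun t => by
    refine (hGt t).exists_forall_le (tendsto_atTop_mono (hcoer t) ?_)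
    exact tendsto_atTop_add_const_right _ _
      (tendsto_norm_cocompact_atTop.const_mul_atTop (half_pos hr))
  choose β₀ hβ₀ using hmin
  have hφc : Continuous fun t => G t (β₀ t) :=
    (LipschitzWith.of_le_add_mul' R fun t s =>
      (hβ₀ t (β₀ s)).trans (by simpa using hlip t s (β₀ s) (β₀ s))).continuous
  obtain ⟨b, hbm, hb⟩ := exists_measurable_le_of_convexOn hφc.measurable
    (fun β => (hGβ β).measurable) hGt hconv fun t => ⟨β₀ t, le_rfl⟩
  refine ⟨fun t => G t (β₀ t), b, hφc, hbm, fun t z hz => ?_, fun t β p h => ?_⟩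
  · have := hGle t (b t) z hz
    have := hb t
    linarith
  · exact (hβ₀ t β).trans (hleG t β p h)

end Multiplier

theorem eventually_le_add_of_constraint {N d : ℕ}
    {Ω : Set (EuclideanSpace ℝ (Fin N) × EuclideanSpace ℝ (Fin d))}
    {g : ℕ → EuclideanSpace ℝ (Fin N) × EuclideanSpace ℝ (Fin d) → ℝ}
    {g' : EuclideanSpace ℝ (Fin N) × EuclideanSpace ℝ (Fin d) → ℝ}
    {m : EuclideanSpace ℝ (Fin N) × EuclideanSpace ℝ (Fin d)} {R B r q : ℝ} (hr : 0 < r)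
    (hrΩ : ball m r ⊆ Ω) (hm1 : m.1 = 0) (hm2 : ‖m.2‖ ≤ R) (hB : ∀ n, ∀ z ∈ ball m r, g n z ≤ B)
    (hlim : ∀ z ∈ Ω, Tendsto (fun n => g n z) atTop (𝓝 (g' z)))
    {t : EuclideanSpace ℝ (Fin d)} {p : ℕ → ℝ} {β : ℕ → EuclideanSpace ℝ (Fin N)}
    (hcon : ∀ n, ∀ z ∈ Ω, inner ℝ t z.2 ≤ g n z + (p n + inner ℝ (β n) z.1))
    (hq : ∀ γ s, (∀ z ∈ Ω, inner ℝ t z.2 ≤ g' z + (s + inner ℝ γ z.1)) → q ≤ s)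
    {ε : ℝ} (hε : 0 < ε) : ∀ᶠ n in atTop, q ≤ p n + ε := by
  by_contra hnot
  rw [not_eventually] at hnot
  have hfreq : ∃ᶠ n in atTop, p n ≤ q - ε ∧ β n ∈ closedBall 0 ((q + B + ‖t‖ * R) / (r / 2)) := by
    refine hnot.mono fun n hn => ?_
    have h1 : p n ≤ q - ε := by linarith
    refine ⟨h1, ?_⟩
    rw [mem_closedBall, dist_zero_right, le_div_iff₀ (by positivity), mul_comm]
    have := mul_norm_le_of_constraint hr hm1 hm2 (hB n) (fun z hz => hcon n z (hrΩ hz))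
    linarith
  obtain ⟨k, hk, hkp⟩ := extraction_of_frequently_atTop hfreq
  obtain ⟨γ, -, j, hj, hγ⟩ := (isCompact_closedBall _ _).tendsto_subseq fun n => (hkp n).2
  have hle : q ≤ q - ε := by
    refine hq γ _ fun z hz => ?_
    have h1 : Tendsto (fun n => g (k (j n)) z + (q - ε + inner ℝ (β (k (j n))) z.1)) atTop
        (𝓝 (g' z + (q - ε + inner ℝ γ z.1))) :=
      ((hlim z hz).comp (hk.comp hj).tendsto_atTop).add
        (tendsto_const_nhds.add (hγ.inner tendsto_const_nhds))
    refine ge_of_tendsto' h1 fun n => (hcon (k (j n)) z hz).trans ?_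
    have := (hkp (j n)).1
    linarith
  linarith

theorem continuousDualValues_nonempty {N d : ℕ}
    {ν : Measure (EuclideanSpace ℝ (Fin N) × EuclideanSpace ℝ (Fin d))} {R D : ℝ}
    (hR : ∀ z ∈ ν.support, ‖z‖ ≤ R) (hD : ∀ t ∈ unitCube d, ‖t‖ ≤ D) :
    (continuousDualValues ν).Nonempty := by
  refine ⟨_, fun _ => D * R, fun _ => 0, fun _ => 0, continuousOn_const, continuousOn_const,
    continuousOn_const, fun z hz t ht => ?_, rfl⟩
  simp only [← EReal.coe_add, EReal.coe_le_coe_iff, inner_zero_left, add_zero]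
  exact (real_inner_le_norm _ _).trans (mul_le_mul (hD t ht) ((norm_snd_le z).trans (hR z hz))
    (norm_nonneg _) ((norm_nonneg t).trans (hD t ht)))

theorem mainTheorem2 (N d : ℕ)
    (ν : Measure (EuclideanSpace ℝ (Fin N) × EuclideanSpace ℝ (Fin d))) [IsProbabilityMeasure ν]
    -- the first marginal is centered: `E(X) = 0`
    (hcentered : ∫ z, z.1 ∂ν = 0)
    -- `spt ν` is the closure of an open bounded convex set
    (Ω : Set (EuclideanSpace ℝ (Fin N) × EuclideanSpace ℝ (Fin d)))
    (hopen : IsOpen Ω) (hbdd : Bornology.IsBounded Ω) (hconv : Convex ℝ Ω)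
    (hsupp : ν.support = closure Ω)
    -- `ν` has a density `f ∈ L^∞(Ω)`
    (f : EuclideanSpace ℝ (Fin N) × EuclideanSpace ℝ (Fin d) → ℝ)
    (hf : MemLp f ∞ (volume.restrict Ω))
    (hν : ν = (volume.restrict Ω).withDensity (fun z => ENNReal.ofReal (f z)))
    -- the density is bounded away from zero on compact subsets of `Ω`
    (hlow : ∀ K : Set (EuclideanSpace ℝ (Fin N) × EuclideanSpace ℝ (Fin d)),
      IsCompact K → K ⊆ Ω → ∃ α : ℝ, 0 < α ∧ ∀ᵐ z ∂(volume.restrict K), α ≤ f z) :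
    ∃ (ψ : EuclideanSpace ℝ (Fin N) × EuclideanSpace ℝ (Fin d) → EReal)
      (φ : EuclideanSpace ℝ (Fin d) → ℝ)
      (b : EuclideanSpace ℝ (Fin d) → EuclideanSpace ℝ (Fin N)),
      IsL1DualSolution ν ψ φ b ∧ ∀ z ∈ Ω, ψ z ≠ ⊤ ∧ ψ z ≠ ⊥ := by
  have hsc : IsCompact ν.support := hsupp ▸ hbdd.isCompact_closure
  have hΩs : Ω ⊆ ν.support := hsupp ▸ subset_closure
  have hΩae : ∀ᵐ z ∂ν, z ∈ Ω := by
    rw [hν]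
    exact (withDensity_absolutelyContinuous _ _).ae_le (ae_restrict_mem hopen.measurableSet)
  obtain ⟨R, hR⟩ := hsc.isBounded.exists_norm_le
  obtain ⟨D, hD⟩ := (isCompact_unitCube d).isBounded.exists_norm_le
  set m := ∫ z, z ∂ν with hm
  have hid : Integrable (fun z : EuclideanSpace ℝ (Fin N) × EuclideanSpace ℝ (Fin d) => z) ν :=
    continuous_id.continuousOn.integrable_of_isCompact_support hsc
  have hmΩ : m ∈ Ω := integral_id_mem_of_convex_isOpen hopen hconv hΩae hid
  have hm1 : m.1 = 0 := by
    rw [← hcentered, hm]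
    exact ((ContinuousLinearMap.fst ℝ _ _).integral_comp_comm hid).symm
  have hm2 : ‖m.2‖ ≤ R := (norm_snd_le m).trans (hR m (hΩs hmΩ))
  set C := 2 * D * R with hC
  have hnorm := fun c hc => exists_normalized_triple (c := c) hsc hcentered (hΩs hmΩ) hm1 hR hD hc
  have hgint : ∀ g : EuclideanSpace ℝ (Fin N) × EuclideanSpace ℝ (Fin d) → ℝ,
      ConvexOn ℝ Set.univ g → Integrable g ν := fun g hg =>
    hg.locallyLipschitz.continuous.continuousOn.integrable_of_isCompact_support hsc
  have hglow : ∀ g : EuclideanSpace ℝ (Fin N) × EuclideanSpace ℝ (Fin d) → ℝ,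
      ConvexOn ℝ Set.univ g → (∀ z ∈ ν.support, -C ≤ g z) → -C ≤ ∫ z, g z ∂ν := by
    intro g hg hgC
    have := integral_mono_ae (integrable_const (-C)) (hgint g hg)
      ((ae_mem_support ν).mono fun z hz => hgC z hz)
    simpa using this
  have hφlow : ∀ φ : EuclideanSpace ℝ (Fin d) → ℝ, ContinuousOn φ (unitCube d) →
      (∀ t ∈ unitCube d, -C ≤ φ t) → -C ≤ ∫ t, φ t ∂(uniformCube d) := by
    intro φ hφ hφC
    have := integral_mono_ae (integrable_const (-C)) hφ.integrable_uniformCube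
      ((ae_mem_unitCube d).mono fun t ht => hφC t ht)
    simpa using this
  have hne := continuousDualValues_nonempty hR hD
  have hbelow : BddBelow (continuousDualValues ν) := by
    refine ⟨-C + -C, fun c hc => ?_⟩
    obtain ⟨g, φ, b, hg, hgC, hφ, hφC, -, hle⟩ := hnorm c hc
    linarith [hglow g hg hgC, hφlow φ hφ hφC]
  set V := sInf (continuousDualValues ν) with hV
  have hglb : IsGLB (continuousDualValues ν) V := isGLB_csInf hne hbelow
  have hseq : ∀ n : ℕ, ∃ c ∈ continuousDualValues ν, c < V + 1 / ((n : ℝ) + 1) := fun n =>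
    exists_lt_of_csInf_lt hne (lt_add_of_pos_right V Nat.one_div_pos_of_nat)
  choose c hc hcV using hseq
  choose g φ b hg hgC hφ hφC hcon hcost using fun n => hnorm (c n) (hc n)
  have hVn : ∀ n : ℕ, (∫ z, g n z ∂ν) + ∫ t, φ n t ∂(uniformCube d) ≤ V + 1 / ((n : ℝ) + 1) :=
    fun n => (hcost n).trans (hcV n).le
  have hone : ∀ n : ℕ, 1 / ((n : ℝ) + 1) ≤ 1 := fun n => by
    rw [div_le_one (by positivity)]
    linarith [Nat.cast_nonneg (α := ℝ) n]
  have hI : ∀ n, ∫ z, g n z ∂ν ∈ Set.Icc (-C) (V + 1 + C) := fun n =>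
    ⟨hglow _ (hg n) (hgC n), by linarith [hVn n, hone n, hφlow _ (hφ n) (hφC n)]⟩
  have hJ : ∀ n, ∫ t, φ n t ∂(uniformCube d) ∈ Set.Icc (-C) (V + 1 + C) := fun n =>
    ⟨hφlow _ (hφ n) (hφC n), by linarith [hVn n, hone n, hglow _ (hg n) (hgC n)]⟩
  have : (volume : Measure (EuclideanSpace ℝ (Fin N) × EuclideanSpace ℝ (Fin d))).IsAddHaarMeasure :=
    inferInstanceAs (Measure.prod volume volume).IsAddHaarMeasure
  have hbd : ∀ z ∈ Ω, ∃ r > 0, ∃ B, ball z r ⊆ Ω ∧ ∀ n, ∀ w ∈ ball z r, g n w ≤ B := by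
    intro z hz
    obtain ⟨r, hr, B, hrΩ, hB⟩ := exists_ball_le_of_integral_le hopen hν hlow hz C (V + 1 + C)
    exact ⟨r, hr, B, hrΩ, fun n => hB (g n) (hg n) (fun w hw => hgC n w (hΩs hw))
      (hgint _ (hg n)) (hI n).2⟩
  obtain ⟨k₁, hk₁, g', hg'₁⟩ := exists_subseq_tendsto_of_convexOn (Ω := Ω) hg fun z hz => by
    obtain ⟨r, hr, B, hrΩ, hB⟩ := hbd z hz
    refine ⟨r, hr, max B C, fun n w hw => abs_le.2 ⟨?_, (hB n w hw).trans (le_max_left _ _)⟩⟩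
    linarith [hgC n w (hΩs (hrΩ hw)), le_max_right B C]
  obtain ⟨A, -, k₂, hk₂, hA⟩ := (isCompact_Icc.prod isCompact_Icc).tendsto_subseq
    (x := fun n => (∫ z, g (k₁ n) z ∂ν, ∫ t, φ (k₁ n) t ∂(uniformCube d)))
    fun n => ⟨hI (k₁ n), hJ (k₁ n)⟩
  set k := fun n => k₁ (k₂ n) with hk
  have hkmono : StrictMono k := hk₁.comp hk₂
  have hA1 : Tendsto (fun n => ∫ z, g (k n) z ∂ν) atTop (𝓝 A.1) :=
    (continuous_fst.tendsto A).comp hA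
  have hA2 : Tendsto (fun n => ∫ t, φ (k n) t ∂(uniformCube d)) atTop (𝓝 A.2) :=
    (continuous_snd.tendsto A).comp hA
  have hAV : A.1 + A.2 ≤ V := by
    have h1 : Tendsto (fun n => V + 1 / ((k n : ℝ) + 1)) atTop (𝓝 (V + 0)) :=
      tendsto_const_nhds.add
        (tendsto_one_div_add_atTop_nhds_zero_nat.comp hkmono.tendsto_atTop)
    rw [add_zero] at h1
    exact le_of_tendsto_of_tendsto' (hA1.add hA2) h1 fun n => hVn (k n)
  have hg' : ∀ z ∈ Ω, Tendsto (fun n => g (k n) z) atTop (𝓝 (g' z)) := fun z hz =>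
    (hg'₁ z hz).comp hk₂.tendsto_atTop
  have hg'C : ∀ z ∈ Ω, -C ≤ g' z := fun z hz =>
    ge_of_tendsto' (hg' z hz) fun n => hgC _ z (hΩs hz)
  have hg'conv : ConvexOn ℝ Ω g' := ⟨hconv, fun z hz w hw p q hp hq hpq =>
    le_of_tendsto_of_tendsto' (hg' _ (hconv hz hw hp hq hpq))
      (((hg' z hz).const_smul p).add ((hg' w hw).const_smul q))
      fun n => (hg (k n)).2 (Set.mem_univ z) (Set.mem_univ w) hp hq hpq⟩
  obtain ⟨r, hr, B, hrΩ, hB⟩ := hbd m hmΩ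
  obtain ⟨φ', b', hφ'c, hb'm, hcon', hopt⟩ := exists_optimal_multiplier (g := g') (B := B)
    (fun z hz => hR z (hΩs hz)) hg'C hr hrΩ hm1
    fun z hz => le_of_tendsto' (hg' z (hrΩ hz)) fun n => hB _ z hz
  have hpsi := integrable_and_integral_le_of_eventually_le (μ := ν) (g := g') (C := C)
    (fun n => hgint _ (hg (k n)))
    (fun n => hΩae.mono fun z hz => hgC (k n) z (hΩs hz))
    (by
      have h1 := (hg'conv.continuousOn hopen).aestronglyMeasurable (μ := ν) hopen.measurableSet
      rwa [Measure.restrict_eq_self_of_ae_mem hΩae] at h1)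
    (hΩae.mono fun z hz => hg'C z hz)
    (hΩae.mono fun z hz ε hε => by
      filter_upwards [(hg' z hz).eventually (lt_mem_nhds (show g' z - ε < g' z by linarith))]
        with n hn
      linarith) hA1
  obtain ⟨C', hC'⟩ := (isCompact_unitCube d).exists_bound_of_continuousOn hφ'c.continuousOn
  have hphi := integrable_and_integral_le_of_eventually_le (μ := uniformCube d) (g := φ')
    (C := max C C') (fun n => (hφ (k n)).integrable_uniformCube)
    (fun n => (ae_mem_unitCube d).mono fun t ht =>
      (neg_le_neg (le_max_left _ _)).trans (hφC (k n) t ht))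
    hφ'c.aestronglyMeasurable
    ((ae_mem_unitCube d).mono fun t ht =>
      (neg_le_neg (le_max_right _ _)).trans (abs_le.1 (hC' t ht)).1)
    ((ae_mem_unitCube d).mono fun t ht ε hε =>
      eventually_le_add_of_constraint hr hrΩ hm1 hm2 (fun n => hB (k n)) hg'
        (fun n z hz => hcon (k n) z (hΩs hz) t ht) (fun γ s h => hopt t γ s h) hε) hA2
  have hb'i : Integrable b' (uniformCube d) := by
    refine Integrable.of_bound hb'm.aestronglyMeasurable ((C' + B + D * |R|) / (r / 2))
      ((ae_mem_unitCube d).mono fun t ht => ?_)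
    rw [le_div_iff₀ (by positivity), mul_comm]
    have h1 := mul_norm_le_of_constraint (g := g') (B := B) hr hm1 hm2
      (fun z hz => le_of_tendsto' (hg' z (hrΩ hz)) fun n => hB _ z hz)
      fun z hz => hcon' t z (hrΩ hz)
    have h2 := (abs_le.1 (hC' t ht)).2
    have h3 : ‖t‖ * R ≤ D * |R| :=
      mul_le_mul (hD t ht) (le_abs_self R) ((norm_nonneg _).trans hm2)
        ((norm_nonneg t).trans (hD t ht))
    linarith
  classical
  set ψ : EuclideanSpace ℝ (Fin N) × EuclideanSpace ℝ (Fin d) → EReal :=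
    fun z => if z ∈ Ω then (g' z : EReal) else ⊤ with hψ
  have hψΩ : ∀ z ∈ Ω, ψ z = (g' z : EReal) := fun z hz => if_pos hz
  have hψae : (fun z => (ψ z).toReal) =ᵐ[ν] g' := hΩae.mono fun z hz => by
    simp only [hψΩ z hz, EReal.toReal_coe]
  have hfin : ∀ z ∈ Ω, ψ z ≠ ⊤ ∧ ψ z ≠ ⊥ := fun z hz => by
    rw [hψΩ z hz]
    exact ⟨EReal.coe_ne_top _, EReal.coe_ne_bot _⟩
  have hadm : IsL1Admissible ν ψ φ' b' := by
    refine ⟨hΩae.mono hfin, hpsi.1.congr hψae.symm, hphi.1, hb'i, fun z _ t _ => ?_⟩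
    by_cases hz : z ∈ Ω
    · rw [hψΩ z hz, ← EReal.coe_add, EReal.coe_le_coe_iff]
      exact hcon' t z hz
    · rw [hψ]
      simp only [if_neg hz, EReal.top_add_coe, le_top]
  have hle : dualCost ν ψ φ' ≤ V := by
    rw [dualCost, integral_congr_ae hψae]
    linarith [hpsi.2, hphi.2]
  have hge : ∀ ψ₁ φ₁ b₁, IsL1Admissible ν ψ₁ φ₁ b₁ → V ≤ dualCost ν ψ₁ φ₁ := by
    refine fun ψ₁ φ₁ b₁ h => le_of_forall_pos_le_add fun ε hε => ?_
    obtain ⟨c', hc', hc'le⟩ := exists_continuousDualValues_le hsc h hε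
    exact (hglb.1 hc').trans hc'le
  refine ⟨ψ, φ', b', ⟨hadm, ?_, fun ψ₁ φ₁ b₁ h => hle.trans (hge ψ₁ φ₁ b₁ h)⟩, hfin⟩
  rwa [le_antisymm hle (hge ψ φ' b' hadm)]
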